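/- Let $\{0,1\}^*$ be the set of finite binary words. For words $\tau,\omega$ with $|\tau|\le|\omega|$ let $$T(\tau,\omega)=\frac{1}{|\omega|-|\tau|+1}\,\#\bigl\{0\le i\le|\omega|-|\tau| : \omega_i\omega_{i+1}\cdots\omega_{i+|\tau|-1}=\tau\bigr\}$$ be the frequency of $\tau$ as a subword of $\omega$, and let $T(\tau,\omega)=0$ if $|\tau|>|\omega|$. For an integer $k\ge 1$ and $p\in[0,1]$ let $1^{k+1}$ be the word of $k+1$ ones, let $$\mathcal B_n=\bigl\{\omega\in\{0,1\}^n : T(1^{k+1},\omega)\le p\bigr\},$$ and let $$C_{k,p}=\limsup_{n\to\infty}\frac1n\log_2|\mathcal B_n|$$ be the capacity of the $(0,k,p)$-RLL semiconstrained system. **Theorem.** For all integers $k\ge 1$ and all real $p$ with $0\le p\le 2^{-(k+1)}$, $$C_{k,p}\ \ge\ 1-\frac{1-p}{2^{k+1}-1}\log_2\!\left(\frac{2-2p}{1+2p(2^k-1)}\right)-p\log_2\!\left(\frac{2p(2^{k+1}-1)}{1+2p(2^k-1)}\right),$$ where for $p=0$ the last term is $0$ (the convention $0\log_2 0=0$).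 -/

import Mathlib

open Filter

namespace SCS

variable {α : Type*}

/-- The subword `ω_i ω_{i+1} ⋯ ω_{i+m-1}` of `ω`, of length `m` and starting at position `i`
(used only for `i + m ≤ |ω|`). -/
def subword (ω : List α) (i m : ℕ) : List α :=
  (ω.drop i).take m

/-- The frequency `T(τ, ω)` of `τ` as a subword of `ω`: the fraction of the `|ω| - |τ| + 1`
starting positions at which `τ` occurs; it is `0` when `τ` is longer than `ω`. -/
noncomputable def freq [DecidableEq α] (τ ω : List α) : ℝ :=
  if ω.length < τ.length then 0
  else (((Finset.range (ω.length - τ.length + 1)).filter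
      (fun i => subword ω i τ.length = τ)).card : ℝ)
    / ((ω.length - τ.length + 1 : ℕ) : ℝ)

/-- The semiconstrained system `X(F, P)`: all words in which every `φ ∈ F` has frequency at
most `P φ`. -/
def system [DecidableEq α] (F : Finset (List α)) (P : F → ℝ) : Set (List α) :=
  {ω | ∀ φ : F, freq (φ : List α) ω ≤ P φ}

/-- `B_n(F, P)`: the words of length exactly `n` in `X(F, P)`. -/
def words [DecidableEq α] (F : Finset (List α)) (P : F → ℝ) (n : ℕ) : Set (List α) :=
  {ω | ω ∈ system F P ∧ ω.length = n}

/-- `B_n(F, P)` is finite over a finite alphabet, so that its cardinality is a natural number. -/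
theorem words_finite [DecidableEq α] [Finite α] (F : Finset (List α)) (P : F → ℝ) (n : ℕ) :
    (words F P n).Finite :=
  (List.finite_length_eq α n).subset (fun _ h => h.2)

/-- The base-2 logarithm of a cardinality, with `log₂ 0 = -∞`. -/
noncomputable def log2Card (m : ℕ) : EReal :=
  if m = 0 then ⊥ else ((Real.logb 2 (m : ℝ) : ℝ) : EReal)

/-- The capacity `limsup_{n → ∞} (1/n) log₂ |B_n(F, P)|` of `X(F, P)`, as an extended real
number (it is `-∞` if `B_n(F, P)` is eventually empty). -/
noncomputable def capacity [DecidableEq α] [Finite α] (F : Finset (List α)) (P : F → ℝ) : EReal :=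
  limsup (fun n : ℕ => ((1 / (n : ℝ) : ℝ) : EReal) * log2Card (words F P n).ncard) atTop

/-- `C_{k,p}`: the capacity of the `(0,k,p)`-RLL semiconstrained system, that is, of the binary
system with the single offending word `1^{k+1}` and `P(1^{k+1}) = p`. -/
noncomputable def rllCapacity (k : ℕ) (p : ℝ) : EReal :=
  capacity ({List.replicate (k + 1) (1 : Fin 2)} : Finset (List (Fin 2))) (fun _ => p)

end SCS

/-!
The bound is the entropy rate of a stationary process, so it follows by counting typical words.
Consider the process that emits independent fair bits, except that a letter emitted after at least
`k` ones in a row is `1` with probability `x ≤ 1/2`. The process has at least `k` ones behind it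
for a fraction `π = 1 / ((1 - x)(2^(k+1) - 2) + 1)` of the time (`occupancy`), so `1^{k+1}` occurs
with frequency `x π`, and the entropy rate is
`1 - π (x log₂ (2x) + (1 - x) log₂ (2(1 - x)))` (`entropyRate`). The choice
`x = p (2^(k+1) - 1) / (1 + 2p(2^k - 1))` gives `x π = p` and turns the entropy rate into the bound.

The law of large numbers is obtained from an explicit solution of the Poisson equation
(`corrector`): after correction by a bounded function of the current run of ones, the number of
letters `c` emitted after at least `k` ones is a martingale with bounded increments
(`sum_transProb_mul_deviation`), its second moment grows linearly (`expect_deviation_sq_le`), and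
Chebyshev's inequality yields a set of typical words of probability at least `1/2`
(`half_le_sum_typical`). The probability of a word depends only on its length and these two counts
(`wordProb_mul_two_pow`), which bounds the probability of each typical word from above and hence
their number from below (`le_logb_card_typical`).

Typical words satisfy the constraint only if `x π < p` or `x = 0`
(`entropyRate_le_rllCapacity`). For `p > 0` the parameter `x` is therefore approached from below,
and the entropy rate is continuous; for `p = 0` the parameter `x = 0` serves directly.
Since `1^{k+1}` is a palindrome, words may be generated from right to left, which matches the
recursive structure of lists.
-/

open Filter

namespace SCS

/-! ### Words and runs of ones -/

/-- The length of the run of ones at the head of a word. -/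
def headRun : List (Fin 2) → ℕ
  | [] => 0
  | b :: ω => if b = 1 then headRun ω + 1 else 0

/-- The number of positions of a word at which the letter `c` stands and is followed by at least
`k` ones. For `c = 1` this is the number of occurrences of `1^{k+1}`. -/
def hits (k : ℕ) (c : Fin 2) : List (Fin 2) → ℕ
  | [] => 0
  | b :: ω => hits k c ω + if k ≤ headRun ω ∧ b = c then 1 else 0

theorem le_headRun_of_take_eq_replicate (m : ℕ) (ω : List (Fin 2))
    (h : ω.take m = List.replicate m 1) : m ≤ headRun ω := by
  induction m generalizing ω with
  | zero => exact Nat.zero_le _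
  | succ m ih =>
    cases ω with
    | nil => simp [List.replicate_succ] at h
    | cons b ω =>
      rw [List.take_succ_cons, List.replicate_succ, List.cons.injEq] at h
      simpa [headRun, h.1] using ih ω h.2

theorem card_subword_eq_replicate_le_hits (k : ℕ) (ω : List (Fin 2)) (N : ℕ) :
    ((Finset.range N).filter
      (fun i => subword ω i (k + 1) = List.replicate (k + 1) 1)).card ≤ hits k 1 ω := by
  induction ω generalizing N with
  | nil => simp [subword, hits, List.replicate_succ]
  | cons b ω ih =>
    cases N with
    | zero => simp
    | succ N =>
      rw [Finset.card_filter, Finset.sum_range_succ', ← Finset.card_filter, hits]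
      refine Nat.add_le_add (ih N) ?_
      by_cases h : subword (b :: ω) 0 (k + 1) = List.replicate (k + 1) 1
      · rw [if_pos h]
        have h' := h
        rw [subword, List.drop_zero, List.take_succ_cons, List.replicate_succ,
          List.cons.injEq] at h'
        simp [le_headRun_of_take_eq_replicate k ω h'.2, h'.1]
      · simp [h]

/-- The finite set of binary words of length `n`. -/
def wordsOfLength : ℕ → Finset (List (Fin 2))
  | 0 => {[]}
  | n + 1 => (wordsOfLength n ×ˢ Finset.univ).image fun q => q.2 :: q.1

theorem length_eq_of_mem_wordsOfLength {n : ℕ} {ω : List (Fin 2)} (h : ω ∈ wordsOfLength n) :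
    ω.length = n := by
  induction n generalizing ω with
  | zero => simpa [wordsOfLength] using h
  | succ n ih =>
    simp only [wordsOfLength, Finset.mem_image, Finset.mem_product] at h
    obtain ⟨q, hq, rfl⟩ := h
    simp [ih hq.1]

theorem sum_wordsOfLength_succ (n : ℕ) (F : List (Fin 2) → ℝ) :
    ∑ ω ∈ wordsOfLength (n + 1), F ω = ∑ ω ∈ wordsOfLength n, ∑ b, F (b :: ω) := by
  rw [wordsOfLength, Finset.sum_image, Finset.sum_product]
  rintro ⟨a, b⟩ - ⟨c, d⟩ - h
  simp only [List.cons.injEq] at h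
  simp [h.1, h.2]

/-! ### The Markov chain -/

/-- The law of a letter emitted after at least `k` ones: `1` has probability `x`. -/
noncomputable def biasedProb (x : ℝ) (b : Fin 2) : ℝ := if b = 1 then x else 1 - x

/-- The law of the next letter after a run of `s` ones. -/
noncomputable def transProb (k : ℕ) (x : ℝ) (s : ℕ) (b : Fin 2) : ℝ :=
  if k ≤ s then biasedProb x b else 1 / 2

/-- The probability of a word generated from right to left by the chain. -/
noncomputable def wordProb (k : ℕ) (x : ℝ) : List (Fin 2) → ℝ
  | [] => 1
  | b :: ω => wordProb k x ω * transProb k x (headRun ω) b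

/-- The expectation of `F` over random words of length `n`. -/
noncomputable def expect (k : ℕ) (x : ℝ) (n : ℕ) (F : List (Fin 2) → ℝ) : ℝ :=
  ∑ ω ∈ wordsOfLength n, wordProb k x ω * F ω

theorem biasedProb_nonneg {x : ℝ} (h0 : 0 ≤ x) (h1 : x ≤ 1) (b : Fin 2) : 0 ≤ biasedProb x b := by
  unfold biasedProb; split_ifs <;> linarith

theorem biasedProb_le_one {x : ℝ} (h0 : 0 ≤ x) (h1 : x ≤ 1) (b : Fin 2) : biasedProb x b ≤ 1 := by
  unfold biasedProb; split_ifs <;> linarith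

theorem transProb_nonneg (k : ℕ) {x : ℝ} (h0 : 0 ≤ x) (h1 : x ≤ 1) (s : ℕ) (b : Fin 2) :
    0 ≤ transProb k x s b := by
  unfold transProb
  split_ifs
  · exact biasedProb_nonneg h0 h1 b
  · norm_num

theorem sum_transProb (k : ℕ) (x : ℝ) (s : ℕ) : ∑ b, transProb k x s b = 1 := by
  rw [Fin.sum_univ_two]
  unfold transProb biasedProb
  split_ifs <;> simp_all
  norm_num

theorem wordProb_nonneg (k : ℕ) {x : ℝ} (h0 : 0 ≤ x) (h1 : x ≤ 1) (ω : List (Fin 2)) :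
    0 ≤ wordProb k x ω := by
  induction ω with
  | nil => simp [wordProb]
  | cons b ω ih => exact mul_nonneg ih (transProb_nonneg k h0 h1 _ b)

theorem expect_succ (k : ℕ) (x : ℝ) (n : ℕ) (F : List (Fin 2) → ℝ) :
    expect k x (n + 1) F
      = expect k x n fun ω => ∑ b, transProb k x (headRun ω) b * F (b :: ω) := by
  simp only [expect, sum_wordsOfLength_succ, wordProb, Finset.mul_sum, mul_assoc]

theorem expect_one (k : ℕ) (x : ℝ) (n : ℕ) : expect k x n (fun _ => 1) = 1 := by
  induction n with
  | zero => simp [expect, wordsOfLength, wordProb]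
  | succ n ih => simp only [expect_succ, mul_one, sum_transProb, ih]

theorem expect_mono (k : ℕ) {x : ℝ} (h0 : 0 ≤ x) (h1 : x ≤ 1) (n : ℕ) {F G : List (Fin 2) → ℝ}
    (h : ∀ ω, F ω ≤ G ω) : expect k x n F ≤ expect k x n G :=
  Finset.sum_le_sum fun ω _ => mul_le_mul_of_nonneg_left (h ω) (wordProb_nonneg k h0 h1 ω)

/-- Each letter emitted after fewer than `k` ones costs a factor `1/2`, so the probability of a
word is determined by its length and its two hit counts. -/
theorem wordProb_mul_two_pow (k : ℕ) (x : ℝ) (ω : List (Fin 2)) :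
    wordProb k x ω * 2 ^ ω.length
      = (2 * x) ^ hits k 1 ω * (2 * (1 - x)) ^ hits k 0 ω := by
  induction ω with
  | nil => simp [wordProb, hits]
  | cons b ω ih =>
    have key : wordProb k x (b :: ω) * 2 ^ (b :: ω).length
        = (wordProb k x ω * 2 ^ ω.length) * (2 * transProb k x (headRun ω) b) := by
      rw [wordProb, List.length_cons]; ring
    rw [key, ih]
    by_cases hk : k ≤ headRun ω
    · fin_cases b <;> simp [hits, hk, transProb, biasedProb, pow_succ] <;> ring
    · simp [hits, hk, transProb]

/-! ### The law of large numbers -/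

/-- The stationary probability of having at least `k` ones behind. -/
noncomputable def occupancy (k : ℕ) (x : ℝ) : ℝ := 1 / ((1 - x) * (2 ^ (k + 1) - 2) + 1)

/-- The solution `f` of the Poisson equation `f s - E (f s') = 1_{k ≤ s} - π` of the chain of run
lengths, normalized by `f 0 = 0`. -/
noncomputable def corrector (k : ℕ) (x : ℝ) (s : ℕ) : ℝ :=
  2 * occupancy k x * (2 ^ min s k - 1)

/-- The centred number of letters `c` emitted after at least `k` ones, corrected by a bounded
function of the head run so as to be a martingale. -/
noncomputable def deviation (k : ℕ) (x : ℝ) (c : Fin 2) (ω : List (Fin 2)) : ℝ :=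
  hits k c ω - biasedProb x c * (occupancy k x * ω.length - corrector k x (headRun ω))

theorem one_le_occupancy_denom (k : ℕ) {x : ℝ} (h1 : x ≤ 1) :
    1 ≤ (1 - x) * (2 ^ (k + 1) - 2) + 1 := by
  have h2 : (1 : ℝ) ≤ 2 ^ k := one_le_pow₀ (by norm_num)
  have : 0 ≤ (1 - x) * ((2 : ℝ) ^ (k + 1) - 2) :=
    mul_nonneg (by linarith) (by rw [pow_succ]; linarith)
  linarith

theorem occupancy_nonneg (k : ℕ) {x : ℝ} (h1 : x ≤ 1) : 0 ≤ occupancy k x :=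
  div_nonneg zero_le_one (zero_le_one.trans (one_le_occupancy_denom k h1))

theorem occupancy_le_one (k : ℕ) {x : ℝ} (h1 : x ≤ 1) : occupancy k x ≤ 1 :=
  div_le_one_of_le₀ (one_le_occupancy_denom k h1)
    (zero_le_one.trans (one_le_occupancy_denom k h1))

theorem corrector_nonneg (k : ℕ) {x : ℝ} (h1 : x ≤ 1) (s : ℕ) : 0 ≤ corrector k x s := by
  have h2 : (1 : ℝ) ≤ 2 ^ min s k := one_le_pow₀ (by norm_num)
  exact mul_nonneg (mul_nonneg zero_le_two (occupancy_nonneg k h1)) (by linarith)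

theorem corrector_le (k : ℕ) {x : ℝ} (h1 : x ≤ 1) (s : ℕ) : corrector k x s ≤ 2 ^ (k + 1) := by
  have h2 : (2 : ℝ) ^ min s k ≤ 2 ^ k := pow_le_pow_right₀ (by norm_num) (min_le_right _ _)
  have h3 : (1 : ℝ) ≤ 2 ^ min s k := one_le_pow₀ (by norm_num)
  have := mul_le_mul_of_nonneg_right (occupancy_le_one k h1)
    (by linarith : (0 : ℝ) ≤ 2 ^ min s k - 1)
  unfold corrector
  rw [pow_succ]
  nlinarith

theorem sum_transProb_mul_deviation (k : ℕ) {x : ℝ} (h1 : x ≤ 1) (c : Fin 2)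
    (ω : List (Fin 2)) :
    ∑ b, transProb k x (headRun ω) b * deviation k x c (b :: ω) = deviation k x c ω := by
  rw [Fin.sum_univ_two]
  by_cases hk : k ≤ headRun ω
  · have hc : corrector k x (headRun ω) = 2 * occupancy k x * (2 ^ k - 1) := by
      simp [corrector, hk]
    have hc' : corrector k x (headRun ω + 1) = 2 * occupancy k x * (2 ^ k - 1) := by
      simp [corrector, hk.trans (Nat.le_succ _)]
    have hc0 : corrector k x 0 = 0 := by simp [corrector]
    have hπ : occupancy k x * ((1 - x) * (2 ^ (k + 1) - 2) + 1) = 1 :=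
      one_div_mul_cancel (by linarith [one_le_occupancy_denom k h1])
    fin_cases c <;> simp [deviation, hits, headRun, transProb, biasedProb, hk, hc, hc', hc0]
    · rw [pow_succ] at hπ
      linear_combination (-(1 - x)) * hπ
    · rw [pow_succ] at hπ
      linear_combination (-x) * hπ
  · have hlt : headRun ω < k := not_le.mp hk
    have hc : corrector k x (headRun ω) = 2 * occupancy k x * (2 ^ headRun ω - 1) := by
      simp [corrector, hlt.le]
    have hc' : corrector k x (headRun ω + 1)
        = 2 * occupancy k x * (2 ^ (headRun ω + 1) - 1) := by
      simp [corrector, Nat.succ_le_of_lt hlt]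
    have hc0 : corrector k x 0 = 0 := by simp [corrector]
    simp [deviation, hits, headRun, transProb, hk, hc, hc', hc0]
    ring

theorem abs_deviation_cons_sub_le (k : ℕ) {x : ℝ} (h0 : 0 ≤ x) (h1 : x ≤ 1) (c b : Fin 2)
    (ω : List (Fin 2)) :
    |deviation k x c (b :: ω) - deviation k x c ω| ≤ 2 ^ (k + 1) + 2 := by
  have hy0 := biasedProb_nonneg h0 h1 c
  have hy1 := biasedProb_le_one h0 h1 c
  have e : deviation k x c (b :: ω) - deviation k x c ω
      = (if k ≤ headRun ω ∧ b = c then 1 else 0)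
        + biasedProb x c * (corrector k x (headRun (b :: ω)) - corrector k x (headRun ω)
          - occupancy k x) := by
    simp only [deviation, hits, List.length_cons]
    push_cast
    ring
  have hd : |corrector k x (headRun (b :: ω)) - corrector k x (headRun ω) - occupancy k x|
      ≤ 2 ^ (k + 1) + 1 := by
    rw [abs_le]
    constructor <;>
    linarith [corrector_nonneg k h1 (headRun ω), corrector_le k h1 (headRun ω),
      corrector_nonneg k h1 (headRun (b :: ω)), corrector_le k h1 (headRun (b :: ω)),
      occupancy_nonneg k h1, occupancy_le_one k h1]
  have hi : |(if k ≤ headRun ω ∧ b = c then 1 else 0 : ℝ)| ≤ 1 := by split_ifs <;> simp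
  rw [e]
  refine (abs_add_le _ _).trans ?_
  rw [abs_mul, abs_of_nonneg hy0]
  have := mul_le_mul hy1 hd (abs_nonneg _) zero_le_one
  linarith

theorem expect_deviation_sq_le (k : ℕ) {x : ℝ} (h0 : 0 ≤ x) (h1 : x ≤ 1) (c : Fin 2) (n : ℕ) :
    expect k x n (fun ω => deviation k x c ω ^ 2) ≤ (2 ^ (k + 1) + 2) ^ 2 * n := by
  induction n with
  | zero => simp [expect, wordsOfLength, deviation, hits, headRun, corrector]
  | succ n ih =>
    set C : ℝ := 2 ^ (k + 1) + 2 with hC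
    rw [expect_succ]
    -- The cross term of the square vanishes by the martingale property.
    have hstep : ∀ ω, ∑ b, transProb k x (headRun ω) b * deviation k x c (b :: ω) ^ 2
        ≤ deviation k x c ω ^ 2 + C ^ 2 := by
      intro ω
      have hm := sum_transProb_mul_deviation k h1 c ω
      have hs := sum_transProb k x (headRun ω)
      have hb : ∀ b, transProb k x (headRun ω) b * deviation k x c (b :: ω) ^ 2
          ≤ transProb k x (headRun ω) b * C ^ 2
            + 2 * deviation k x c ω * (transProb k x (headRun ω) b * deviation k x c (b :: ω))
            - transProb k x (headRun ω) b * deviation k x c ω ^ 2 := by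
        intro b
        have h3 := sq_le_sq' (abs_le.mp (abs_deviation_cons_sub_le k h0 h1 c b ω)).1
          (abs_le.mp (abs_deviation_cons_sub_le k h0 h1 c b ω)).2
        have := mul_le_mul_of_nonneg_left h3 (transProb_nonneg k h0 h1 (headRun ω) b)
        nlinarith
      refine (Finset.sum_le_sum fun b _ => hb b).trans ?_
      rw [Finset.sum_sub_distrib, Finset.sum_add_distrib, ← Finset.sum_mul, ← Finset.mul_sum,
        ← Finset.sum_mul, hm, hs]
      nlinarith
    refine (expect_mono k h0 h1 n hstep).trans ?_
    have hadd : expect k x n (fun ω => deviation k x c ω ^ 2 + C ^ 2)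
        = expect k x n (fun ω => deviation k x c ω ^ 2) + C ^ 2 * expect k x n (fun _ => 1) := by
      simp only [expect, mul_add, Finset.sum_add_distrib, Finset.mul_sum, mul_one]
      congr 1
      exact Finset.sum_congr rfl fun _ _ => mul_comm _ _
    rw [hadd, expect_one]
    push_cast
    linarith

/-! ### Typical words -/

open Classical in
/-- The words of length `n` and positive probability whose two deviations are at most `δ n`. -/
noncomputable def typical (k : ℕ) (x δ : ℝ) (n : ℕ) : Finset (List (Fin 2)) :=
  (wordsOfLength n).filter fun ω =>
    0 < wordProb k x ω ∧ ∀ c, |deviation k x c ω| ≤ δ * n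

theorem half_le_sum_typical (k : ℕ) {x δ : ℝ} (h0 : 0 ≤ x) (h1 : x ≤ 1) (hδ : 0 < δ) :
    ∀ᶠ n : ℕ in atTop, 1 / 2 ≤ ∑ ω ∈ typical k x δ n, wordProb k x ω := by
  set C : ℝ := 2 ^ (k + 1) + 2 with hC
  filter_upwards [eventually_gt_atTop 0,
    tendsto_natCast_atTop_atTop.eventually_ge_atTop (4 * C ^ 2 / δ ^ 2)] with n hn0 hn
  have hn0' : (0 : ℝ) < n := by exact_mod_cast hn0
  have hδn : 0 < (δ * n) ^ 2 := by positivity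
  have hpt : ∀ ω, wordProb k x ω * (δ * n) ^ 2
      ≤ (if 0 < wordProb k x ω ∧ ∀ c, |deviation k x c ω| ≤ δ * n then wordProb k x ω else 0)
          * (δ * n) ^ 2
        + (wordProb k x ω * deviation k x 0 ω ^ 2 + wordProb k x ω * deviation k x 1 ω ^ 2) := by
    intro ω
    have hw := wordProb_nonneg k h0 h1 ω
    have hd0 := mul_nonneg hw (sq_nonneg (deviation k x 0 ω))
    have hd1 := mul_nonneg hw (sq_nonneg (deviation k x 1 ω))
    split_ifs with h
    · linarith
    · rw [zero_mul, zero_add]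
      rcases hw.eq_or_lt with hz | hpos
      · simp [← hz]
      · have h' : ∃ c, δ * n < |deviation k x c ω| := by
          by_contra! hcon
          exact h ⟨hpos, hcon⟩
        obtain ⟨c, hc⟩ := h'
        have hsq : (δ * n) ^ 2 ≤ deviation k x c ω ^ 2 := by
          rw [← sq_abs (deviation k x c ω)]
          exact pow_le_pow_left₀ (by positivity) hc.le 2
        have := mul_le_mul_of_nonneg_left hsq hw
        fin_cases c <;> simp at this <;> linarith
  have hsum := Finset.sum_le_sum fun ω (_ : ω ∈ wordsOfLength n) => hpt ω
  rw [Finset.sum_add_distrib, Finset.sum_add_distrib, ← Finset.sum_mul, ← Finset.sum_mul] at hsum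
  have e0 := expect_deviation_sq_le k h0 h1 0 n
  have e1 := expect_deviation_sq_le k h0 h1 1 n
  have et := expect_one k x n
  simp only [expect, mul_one] at e0 e1 et
  rw [et, ← Finset.sum_filter] at hsum
  have hlarge : 4 * C ^ 2 * n ≤ (δ * n) ^ 2 := by
    rw [div_le_iff₀ (by positivity)] at hn
    nlinarith
  refine le_of_mul_le_mul_right (a := (δ * n) ^ 2) ?_ hδn
  have hfin : ∑ ω ∈ typical k x δ n, wordProb k x ω
      = ∑ ω ∈ wordsOfLength n with
          0 < wordProb k x ω ∧ ∀ c, |deviation k x c ω| ≤ δ * n, wordProb k x ω := by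
    unfold typical
    congr!
  rw [hfin]
  linarith

/-- The entropy rate, in bits per letter, of the chain with parameter `x`. At `x = 0` the value
`Real.logb 2 0 = 0` agrees with the convention `0 log 0 = 0`. -/
noncomputable def entropyRate (k : ℕ) (x : ℝ) : ℝ :=
  1 - occupancy k x
    * (x * Real.logb 2 (2 * x) + (1 - x) * Real.logb 2 (2 * (1 - x)))

theorem hits_one_eq_zero_of_wordProb_pos {k : ℕ} {ω : List (Fin 2)} (h : 0 < wordProb k 0 ω) :
    hits k 1 ω = 0 := by
  by_contra hne
  have := wordProb_mul_two_pow k 0 ω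
  rw [mul_zero, zero_pow hne, zero_mul] at this
  have h2 : 0 < wordProb k 0 ω * 2 ^ ω.length := by positivity
  linarith

theorem logb_wordProb {k : ℕ} {x : ℝ} (h0 : 0 ≤ x) (h1 : x < 1) {ω : List (Fin 2)}
    (h : 0 < wordProb k x ω) :
    Real.logb 2 (wordProb k x ω) = -ω.length + hits k 1 ω * Real.logb 2 (2 * x)
      + hits k 0 ω * Real.logb 2 (2 * (1 - x)) := by
  have e := congrArg (Real.logb 2) (wordProb_mul_two_pow k x ω)
  have hpow : (2 * x) ^ hits k 1 ω ≠ 0 := by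
    rcases h0.eq_or_lt with hx | hx
    · subst hx
      simp [hits_one_eq_zero_of_wordProb_pos h]
    · positivity
  have hpow' : (2 * (1 - x)) ^ hits k 0 ω ≠ 0 := pow_ne_zero _ (by linarith)
  rw [Real.logb_mul h.ne' (by positivity), Real.logb_mul hpow hpow', Real.logb_pow,
    Real.logb_pow, Real.logb_pow, Real.logb_self_eq_one (by norm_num)] at e
  linarith

theorem logb_two_mul_nonpos {x : ℝ} (h0 : 0 ≤ x) (h1 : x ≤ 1 / 2) : Real.logb 2 (2 * x) ≤ 0 :=
  Real.logb_nonpos (by norm_num) (by linarith) (by linarith)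

/-- Typical words are at least about `2 ^ (n * entropyRate k x)` in number. -/
theorem le_logb_card_typical (k : ℕ) {x ε : ℝ} (h0 : 0 ≤ x) (h1 : x ≤ 1 / 2) (hε : 0 < ε) :
    ∃ δ₀ > 0, ∀ δ, 0 < δ → δ ≤ δ₀ → ∀ᶠ n : ℕ in atTop,
      0 < (typical k x δ n).card ∧
        n * (entropyRate k x - ε) ≤ Real.logb 2 (typical k x δ n).card := by
  set A := -Real.logb 2 (2 * x) with hA
  set B := Real.logb 2 (2 * (1 - x)) with hB
  have hA0 : 0 ≤ A := by linarith [logb_two_mul_nonpos h0 h1]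
  have hB0 : 0 ≤ B := Real.logb_nonneg (by norm_num) (by linarith)
  refine ⟨ε / 2 / (A + B + 1), by positivity, fun δ hδ hδ₀ => ?_⟩
  have hδε : (A + B) * δ ≤ ε / 2 := by
    rw [le_div_iff₀ (by positivity)] at hδ₀
    linarith
  filter_upwards [half_le_sum_typical k h0 (by linarith) hδ,
    tendsto_natCast_atTop_atTop.eventually_ge_atTop (2 * (A * 2 ^ (k + 1) + 1) / ε)]
    with n hhalf hn
  have hne : (typical k x δ n).Nonempty := by
    by_contra hemp
    rw [Finset.not_nonempty_iff_eq_empty] at hemp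
    rw [hemp, Finset.sum_empty] at hhalf
    norm_num at hhalf
  have hcard := Finset.card_pos.mpr hne
  refine ⟨hcard, ?_⟩
  have hcard' : (0 : ℝ) < (typical k x δ n).card := by exact_mod_cast hcard
  set L := -(n * entropyRate k x) + (A + B) * δ * n + A * 2 ^ (k + 1) with hL
  have hprob : ∀ ω ∈ typical k x δ n, wordProb k x ω ≤ 2 ^ L := by
    intro ω hω
    simp only [typical, Finset.mem_filter] at hω
    obtain ⟨hmem, hpos, hdev⟩ := hω
    have hlen := length_eq_of_mem_wordsOfLength hmem
    rw [← Real.logb_le_iff_le_rpow (by norm_num) hpos, logb_wordProb h0 (by linarith) hpos, hlen]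
    have d0 := (abs_le.mp (hdev 0)).2
    have d1 := (abs_le.mp (hdev 1)).1
    simp only [deviation, hlen, biasedProb] at d0 d1
    norm_num at d0 d1
    have hf := corrector_nonneg k (by linarith : x ≤ 1) (headRun ω)
    have hf' := corrector_le k (by linarith : x ≤ 1) (headRun ω)
    have m0 : (hits k 0 ω : ℝ) ≤ (1 - x) * (occupancy k x * n) + δ * n := by
      have := mul_nonneg (by linarith : 0 ≤ 1 - x) hf
      linarith
    have m1 : x * (occupancy k x * n) - δ * n - 2 ^ (k + 1) ≤ (hits k 1 ω : ℝ) := by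
      have := mul_le_mul_of_nonneg_right (by linarith : x ≤ 1) hf
      linarith
    have p0 := mul_le_mul_of_nonneg_right m0 hB0
    have p1 := mul_le_mul_of_nonneg_right m1 hA0
    have hlog : Real.logb 2 (2 * x) = -A := by rw [hA, neg_neg]
    rw [hL, entropyRate, hlog, ← hB]
    linarith
  have hsum := hhalf.trans (Finset.sum_le_card_nsmul _ _ _ hprob)
  rw [nsmul_eq_mul] at hsum
  have hlog := Real.logb_le_logb_of_le (by norm_num : (1 : ℝ) < 2) (by norm_num) hsum
  rw [Real.logb_mul hcard'.ne' (by positivity), Real.logb_rpow (by norm_num) (by norm_num),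
    one_div, Real.logb_inv, Real.logb_self_eq_one (by norm_num)] at hlog
  rw [div_le_iff₀ hε] at hn
  have hn0 : (0 : ℝ) ≤ n := n.cast_nonneg
  have := mul_le_mul_of_nonneg_right hδε hn0
  linarith

/-! ### The capacity bound -/

theorem freq_replicate_le {k : ℕ} {p : ℝ} (hp : 0 ≤ p) {ω : List (Fin 2)}
    (h : (hits k 1 ω : ℝ) ≤ p * (ω.length - k)) :
    freq (List.replicate (k + 1) (1 : Fin 2)) ω ≤ p := by
  unfold freq
  split_ifs with hlen
  · exact hp
  · rw [List.length_replicate, not_lt] at hlen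
    rw [List.length_replicate, div_le_iff₀ (by positivity)]
    have hcast : ((ω.length - (k + 1) + 1 : ℕ) : ℝ) = ω.length - k := by
      push_cast [Nat.cast_sub hlen]
      ring
    rw [hcast]
    exact le_trans (by exact_mod_cast card_subword_eq_replicate_le_hits k ω _) h

theorem entropyRate_le_rllCapacity (k : ℕ) {x p : ℝ} (h0 : 0 ≤ x) (h1 : x ≤ 1 / 2) (hp : 0 ≤ p)
    (hx : x = 0 ∨ x * occupancy k x < p) : (entropyRate k x : EReal) ≤ rllCapacity k p := by
  refine EReal.ge_of_forall_gt_iff_ge.mp fun v hv => ?_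
  have hv' : v < entropyRate k x := by exact_mod_cast hv
  obtain ⟨δ₀, hδ₀, hev⟩ := le_logb_card_typical k h0 h1 (sub_pos.mpr hv')
  set δ := if x = 0 then δ₀ else min δ₀ ((p - x * occupancy k x) / 2) with hδdef
  have hδ : 0 < δ ∧ δ ≤ δ₀ := by
    rw [hδdef]
    split_ifs with h
    · exact ⟨hδ₀, le_rfl⟩
    · exact ⟨lt_min hδ₀ (by linarith [hx.resolve_left h]), min_le_left _ _⟩
  have hδp : x ≠ 0 → δ ≤ (p - x * occupancy k x) / 2 := fun h => by
    rw [hδdef, if_neg h]; exact min_le_right _ _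
  unfold rllCapacity capacity
  refine le_limsup_of_frequently_le (Eventually.frequently ?_)
  filter_upwards [hev δ hδ.1 hδ.2, eventually_gt_atTop 0, eventually_ge_atTop k,
    tendsto_natCast_atTop_atTop.eventually_ge_atTop (p * k / ((p - x * occupancy k x) / 2))]
    with n ⟨hcard, hlog⟩ hn0 hnk hnp
  have hn0' : (0 : ℝ) < n := by exact_mod_cast hn0
  have hsub : ((typical k x δ n : Finset (List (Fin 2))) : Set (List (Fin 2)))
      ⊆ words ({List.replicate (k + 1) (1 : Fin 2)} : Finset (List (Fin 2))) (fun _ => p) n := by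
    intro ω hω
    simp only [typical, Finset.coe_filter, Set.mem_ofPred_eq] at hω
    obtain ⟨hmem, hpos, hdev⟩ := hω
    have hlen := length_eq_of_mem_wordsOfLength hmem
    refine ⟨?_, hlen⟩
    rintro ⟨φ, hφ⟩
    obtain rfl := Finset.mem_singleton.mp hφ
    refine freq_replicate_le hp ?_
    rw [hlen]
    rcases eq_or_ne x 0 with hx0 | hx0
    · subst hx0
      rw [hits_one_eq_zero_of_wordProb_pos hpos, Nat.cast_zero]
      exact mul_nonneg hp (sub_nonneg.mpr (by exact_mod_cast hnk))
    · have hgap := hx.resolve_left hx0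
      rw [div_le_iff₀ (by linarith)] at hnp
      have d1 := (abs_le.mp (hdev 1)).2
      simp only [deviation, hlen, biasedProb, if_true] at d1
      have hf := mul_nonneg h0 (corrector_nonneg k (by linarith : x ≤ 1) (headRun ω))
      have := mul_le_mul_of_nonneg_right (hδp hx0) hn0'.le
      linarith
  have hle := Set.ncard_le_ncard hsub (words_finite _ _ n)
  rw [Set.ncard_coe_finset] at hle
  have hpos := hcard.trans_le hle
  rw [log2Card, if_neg hpos.ne', ← EReal.coe_mul, EReal.coe_le_coe_iff, one_div,
    inv_mul_eq_div, le_div_iff₀ hn0']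
  have hmono := Real.logb_le_logb_of_le (by norm_num : (1 : ℝ) < 2)
    (by exact_mod_cast hcard : (0 : ℝ) < (typical k x δ n).card)
    (Nat.cast_le.mpr hle)
  linarith

theorem continuousAt_entropyRate (k : ℕ) {x : ℝ} (h0 : 0 < x) (h1 : x < 1) :
    ContinuousAt (entropyRate k) x := by
  have hden := one_le_occupancy_denom k h1.le
  have hx : 2 * x ≠ 0 := by positivity
  have hx' : 2 * (1 - x) ≠ 0 := by linarith
  unfold entropyRate occupancy Real.logb
  fun_prop (disch := first | assumption | linarith)

/-- The frequency of `1^{k+1}` under the chain is strictly increasing in the parameter. -/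
theorem mul_occupancy_lt_mul_occupancy (k : ℕ) {x y : ℝ} (hxy : x < y)
    (h1 : y ≤ 1) : x * occupancy k x < y * occupancy k y := by
  have hy := one_le_occupancy_denom k h1
  have hx := one_le_occupancy_denom k (hxy.le.trans h1)
  have h2 : (1 : ℝ) ≤ 2 ^ k := one_le_pow₀ (by norm_num)
  rw [occupancy, occupancy, mul_one_div, mul_one_div, div_lt_div_iff₀ (by linarith) (by linarith),
    pow_succ]
  nlinarith [mul_nonneg (sub_nonneg.mpr hxy.le) (sub_nonneg.mpr h2)]

end SCS

open SCS in
theorem mainTheorem4 (k : ℕ) (hk : 1 ≤ k) (p : ℝ) (hp0 : 0 ≤ p) (hp1 : p ≤ 1 / 2 ^ (k + 1)) :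
    ((1 - (1 - p) / (2 ^ (k + 1) - 1)
          * Real.logb 2 ((2 - 2 * p) / (1 + 2 * p * (2 ^ k - 1)))
        - p * Real.logb 2 (2 * p * (2 ^ (k + 1) - 1) / (1 + 2 * p * (2 ^ k - 1))) : ℝ) : EReal)
      ≤ SCS.rllCapacity k p := by
  have h2 : (1 : ℝ) ≤ 2 ^ k := one_le_pow₀ (by norm_num)
  rw [le_div_iff₀ (by positivity)] at hp1
  rw [pow_succ] at hp1 ⊢
  set K : ℝ := 2 ^ k with hK
  have hD : 0 < 1 + 2 * p * (K - 1) := by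
    have := mul_nonneg hp0 (sub_nonneg.mpr h2)
    linarith
  have hM : 0 < K * 2 - 1 := by linarith
  set D : ℝ := 1 + 2 * p * (K - 1) with hDdef
  set x : ℝ := p * (K * 2 - 1) / D with hx
  have hx0 : 0 ≤ x := by positivity
  have hx1 : x ≤ 1 / 2 := by
    rw [hx, div_le_iff₀ hD]
    linarith
  have h1x : 1 - x = (1 - p) / D := by
    rw [hx]
    field_simp
    rw [hDdef]
    ring
  have hden : (1 - x) * (K * 2 - 2) + 1 = (K * 2 - 1) / D := by
    rw [h1x]
    field_simp
    rw [hDdef]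
    ring
  have hπ : occupancy k x = D / (K * 2 - 1) := by
    rw [occupancy, pow_succ, ← hK, hden, one_div_div]
  have hfreq : x * occupancy k x = p := by
    rw [hπ, hx]
    field_simp
  have hfreq' : occupancy k x * (1 - x) = (1 - p) / (K * 2 - 1) := by
    rw [hπ, h1x]
    field_simp
  have hrate : 1 - (1 - p) / (K * 2 - 1) * Real.logb 2 ((2 - 2 * p) / D)
      - p * Real.logb 2 (2 * p * (K * 2 - 1) / D) = entropyRate k x := by
    have a1 : (2 - 2 * p) / D = 2 * (1 - x) := by rw [h1x]; ring
    have a2 : 2 * p * (K * 2 - 1) / D = 2 * x := by rw [hx]; ring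
    rw [a1, a2, ← hfreq', entropyRate]
    nth_rewrite 1 [← hfreq]
    ring
  rw [hrate]
  rcases hx0.eq_or_lt with hz | hpos
  · exact entropyRate_le_rllCapacity k hx0 hx1 hp0 (Or.inl hz.symm)
  -- A parameter below `x` gives frequency below `p`, which leaves room for the typical deviation.
  · have hcont : Tendsto (fun y => (entropyRate k y : EReal)) (nhdsWithin x (Set.Iio x))
        (nhds (entropyRate k x : EReal)) :=
      (continuous_coe_real_ereal.tendsto _).comp
        ((continuousAt_entropyRate k hpos (by linarith)).tendsto.mono_left nhdsWithin_le_nhds)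
    refine le_of_tendsto hcont ?_
    filter_upwards [Ioo_mem_nhdsLT hpos] with y hy
    refine entropyRate_le_rllCapacity k hy.1.le (hy.2.le.trans hx1) hp0 (Or.inr ?_)
    rw [← hfreq]
    exact mul_occupancy_lt_mul_occupancy k hy.2 (by linarith)
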